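/- Let $\mathcal X\subset\mathbb R$ be compact, let $\nu_\beta$ be a $\sigma$-finite measure on $\mathbb R$, let $\pi_\lambda=\mathrm{Gamma}(a_\lambda,b_\lambda)$ be the Gamma distribution with shape $a_\lambda>0$ and rate $b_\lambda>0$, and suppose that the product Lévy measure $$\nu(d\beta\,d\lambda\,d\chi)=\nu_\beta(d\beta)\,\pi_\lambda(d\lambda)\,d\chi\quad\text{on }\mathbb R\times\mathbb R^+\times\mathcal X$$ is locally $L_1$-integrable: $\iint_{\mathbb R\times K}(1\wedge|\beta|)\,d\nu<\infty$ for every compact $K\subset(0,\infty)\times\mathcal X$. Let $N$ be a Poisson random measure with intensity $\nu$, let $g:\mathbb R\to\mathbb R$ be bounded and measurable, and let $$f(x)=\int g(\lambda(x-\chi))\,\beta\;N(d\beta\,d\lambda\,d\chi),\qquad x\in\mathbb R,$$ be the one-dimensional Lévy adaptive regression kernel (LARK) model with generating function $g$. For $D\subseteq\mathbb R$, $p,q\ge1$ and $s>0$, let $\mathbb B^s_{pq}(D)$ be the space of all $u\in L_p(D)$ with $$|u|^s_{pq}=\Bigl(2\int_0^1h^{-1-sq}\,\|\Delta_h^mu\|_p^q\,dh\Bigr)^{1/q}<\infty,\qquad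 m=1+\lfloor s\rfloor,$$ where $\Delta_h^m$ is the $m$-th forward difference and $\|\Delta^m_hu\|_p$ is the $L_p$ norm over the set of those $x$ for which $x,x+h,\dots,x+mh$ all lie in $D$. Then, almost surely, the integral defining $f(x)$ converges absolutely for every $x\in\mathbb R$. If $p,q\ge1$, $s>0$, $g\in\mathbb B^s_{pq}(\mathbb R)$ and $a_\lambda>1/p$, then almost surely $f\in\mathbb B^s_{pq}(\mathbb R)$, and $f\in\mathbb B^s_{pq}(\mathcal X)$. In particular, if $a_\lambda\ge1$, then for all $p,q\ge1$ and $s>0$ with $g\in\mathbb B^s_{pq}(\mathbb R)$, almost surely $f\in\mathbb B^s_{pq}(\mathcal X)$, and also $f\in\mathbb B^s_{pq}(\mathbb R)$ unless $a_\lambda=p=1$. -/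

import Mathlib

open MeasureTheory ProbabilityTheory Set
open scoped ENNReal

noncomputable section

/-- The points of `D` from which all of `x, x + h, …, x + m h` lie in `D`. -/
def stepDomain (D : Set ℝ) (m : ℕ) (h : ℝ) : Set ℝ :=
  {x | ∀ k : ℕ, k ≤ m → x + k * h ∈ D}

/-- The Besov seminorm of `f` on `D ⊆ ℝ`,
`(2 ∫₀¹ h^(-1 - s q) ‖Δ_h^m f‖_p^q dh)^(1/q)` with `m = 1 + ⌊s⌋`, where the `L_p` norm of the
`m`-th forward difference is taken over the points where all its arguments lie in `D`
(over all of `ℝ` if `D = univ`). -/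
def besovSeminorm (D : Set ℝ) (p q s : ℝ) (f : ℝ → ℝ) : ℝ≥0∞ :=
  (2 * ∫⁻ h in Ioo (0 : ℝ) 1, ENNReal.ofReal (h ^ (-1 - s * q)) *
    eLpNorm ((fwdDiff h)^[⌊s⌋₊ + 1] f) (ENNReal.ofReal p)
      (volume.restrict (stepDomain D (⌊s⌋₊ + 1) h)) ^ q) ^ (1 / q)

/-- `f ∈ B^s_{pq}(D)`: `f ∈ L_p(D)` with finite Besov seminorm on `D`. -/
def MemBesov (D : Set ℝ) (p q s : ℝ) (f : ℝ → ℝ) : Prop :=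
  MemLp f (ENNReal.ofReal p) (volume.restrict D) ∧ besovSeminorm D p q s f < ∞

/-- The Poisson distribution with mean `r ∈ [0, ∞]`, as a law on `[0, ∞]`; for `r = ∞` it is the
point mass at `∞`. -/
def extPoisson (r : ℝ≥0∞) : Measure ℝ≥0∞ :=
  if r = ∞ then Measure.dirac ∞
  else (poissonMeasure r.toNNReal).map (fun n : ℕ => (n : ℝ≥0∞))

/-- `N` is a Poisson random measure on `E` with intensity `ν`: a random measure that assigns
independent `Po(ν(C_i))` variables `N(C_i)` to disjoint measurable sets `C_i`. -/
structure IsPoissonRandomMeasure {Ω' E : Type*} [MeasurableSpace Ω'] [MeasurableSpace E]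
    (P : Measure Ω') (N : Ω' → Measure E) (ν : Measure E) : Prop where
  measurable : Measurable N
  law : ∀ C : Set E, MeasurableSet C → P.map (fun w => N w C) = extPoisson (ν C)
  indep : ∀ (n : ℕ) (C : Fin n → Set E), (∀ i, MeasurableSet (C i)) →
    Pairwise (fun i j => Disjoint (C i) (C j)) → iIndepFun (fun i w => N w (C i)) P

/-- The product Lévy measure `ν_β(dβ) π_λ(dλ) dχ` on `ℝ × ℝ⁺ × X`, where `π_λ` is the Gamma
distribution with shape `a` and rate `b`; a point `z : ℝ × ℝ × ℝ` is `(β, (λ, χ))`. -/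
def larkLevyMeasure (νβ : Measure ℝ) (a b : ℝ) (X : Set ℝ) : Measure (ℝ × ℝ × ℝ) :=
  νβ.prod ((gammaMeasure a b).prod (volume.restrict X))

/-- Local `L₁` integrability of a Lévy measure `ν` on `ℝ × W`. -/
def LocallyL1 (ν : Measure (ℝ × ℝ × ℝ)) (W : Set (ℝ × ℝ)) : Prop :=
  ∀ K : Set (ℝ × ℝ), IsCompact K → K ⊆ W →
    ∫⁻ z in univ ×ˢ K, ENNReal.ofReal (min 1 |z.1|) ∂ν < ∞

/-- The summand `g(λ (x - χ)) β` contributed at `x` by the support point `(β, (λ, χ))`. -/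
def larkTerm (g : ℝ → ℝ) (x : ℝ) (z : ℝ × ℝ × ℝ) : ℝ :=
  g (z.2.1 * (x - z.2.2)) * z.1

/-- `f(x) = ∫ g(λ (x - χ)) L(dω) = ∬ g(λ (x - χ)) β N(dβ dω)`, the uncompensated stochastic
integral of the location-scale generator of `g`. -/
def larkFun (g : ℝ → ℝ) (N : Measure (ℝ × ℝ × ℝ)) (x : ℝ) : ℝ :=
  ∫ z, larkTerm g x z ∂N

end

/-! The argument is pathwise. Conditionally on `N`, `f` is a superposition of copies of `g` dilated
by `λ` and multiplied by `β`. Scaling turns `‖g‖_p` into `|β| λ^(-1/p) ‖g‖_p`, and bounds the Besov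
seminorm of one copy by a constant times `|β| λ^(s - 1/p)`. Minkowski's integral inequality
(`lintegral_rpow_lintegral_le`) sums these bounds, so it suffices that `∫ |β| λ^t dN < ∞` almost
surely for `t = 0`, `-1/p` and `s - 1/p`.

This is `ae_lintegral_jump_mul_lt_top`. By the product form of `ν`, the integral of `(1 ∧ |β|) λ^t`
factors, and the Gamma moment is finite when `a + t > 0`. The sets `{|β| > n}` have intensity
tending to `0`, so almost surely `N` misses one of them and large jumps cost nothing.

Only `t = -1/p`, the `L_p` norm on the whole line, needs `a > 1/p`. On the compact `X`, `f` is
bounded, and the seminorm already allows `a = 1/p` because `s > 0`. -/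

/-! ### Poisson random measures: mean measure and avoidance of small sets. -/

lemma lintegral_natCast_poissonMeasure (r : NNReal) :
    ∫⁻ n, (n : ℝ≥0∞) ∂(poissonMeasure r) = r := by
  have h0 : ∀ n : ℕ, ENNReal.ofReal (Real.exp (-r) * r ^ (n + 1) / (n + 1).factorial) *
      ((n + 1 : ℕ) : ℝ≥0∞) = r * ENNReal.ofReal (Real.exp (-r) * r ^ n / n.factorial) := by
    intro n
    rw [← ENNReal.ofReal_natCast, ← ENNReal.ofReal_mul (by positivity),
      ← ENNReal.ofReal_coe_nnreal, ← ENNReal.ofReal_mul (by positivity)]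
    congr 1
    rw [Nat.factorial_succ]
    push_cast
    field_simp
    ring
  have h1 : ∑' n : ℕ, ENNReal.ofReal (Real.exp (-r) * r ^ n / n.factorial) = 1 := by
    rw [← ENNReal.ofReal_tsum_of_nonneg (fun n => by positivity)
      (hasSum_one_poissonMeasure r).summable, (hasSum_one_poissonMeasure r).tsum_eq,
      ENNReal.ofReal_one]
  rw [poissonMeasure, lintegral_sum_measure]
  simp only [lintegral_smul_measure, lintegral_dirac, smul_eq_mul]
  rw [tsum_eq_zero_add' ENNReal.summable]
  simp only [h0, ENNReal.tsum_mul_left, h1]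
  simp

lemma lintegral_id_extPoisson (r : ℝ≥0∞) : ∫⁻ x, x ∂(extPoisson r) = r := by
  unfold extPoisson
  split_ifs with h
  · simp [h]
  · rw [lintegral_map measurable_id' .of_discrete, lintegral_natCast_poissonMeasure,
      ENNReal.coe_toNNReal h]

/-- A nonzero count is at least `1`, so this is Markov's inequality. -/
lemma extPoisson_ne_zero_le (r : ℝ≥0∞) : extPoisson r {0}ᶜ ≤ r := by
  by_cases h : r = ∞
  · simp [h]
  calc extPoisson r {0}ᶜ ≤ extPoisson r {x | 1 ≤ x} := by
        have hs : MeasurableSet ({0}ᶜ : Set ℝ≥0∞) := (measurableSet_singleton _).compl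
        have hs' : MeasurableSet {x : ℝ≥0∞ | 1 ≤ x} := measurableSet_Ici
        rw [extPoisson, if_neg h, Measure.map_apply .of_discrete hs,
          Measure.map_apply .of_discrete hs']
        refine measure_mono fun n hn => ?_
        have : n ≠ 0 := by simpa using hn
        simpa using Nat.one_le_iff_ne_zero.2 this
    _ ≤ ∫⁻ x, x ∂(extPoisson r) := by
        simpa using mul_meas_ge_le_lintegral (μ := extPoisson r) measurable_id' 1
    _ = r := lintegral_id_extPoisson r

namespace IsPoissonRandomMeasure

variable {Ω' E : Type*} [MeasurableSpace Ω'] [MeasurableSpace E] {P : Measure Ω'}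
  {N : Ω' → Measure E} {ν : Measure E}

/-- Campbell's formula in measure form: averages over `N` reduce to integrals against `ν`. -/
lemma bind_eq (hN : IsPoissonRandomMeasure P N ν) : P.bind N = ν := by
  ext C hC
  rw [Measure.bind_apply hC hN.measurable.aemeasurable]
  have hm : Measurable fun w => N w C := (Measure.measurable_coe hC).comp hN.measurable
  rw [← lintegral_map (f := fun x => x) measurable_id' hm, hN.law C hC, lintegral_id_extPoisson]

lemma ae_ae (hN : IsPoissonRandomMeasure P N ν) {p : E → Prop} (h : ∀ᵐ z ∂ν, p z) :
    ∀ᵐ w ∂P, ∀ᵐ z ∂(N w), p z :=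
  Measure.ae_ae_of_ae_bind hN.measurable.aemeasurable (hN.bind_eq.symm ▸ h)

lemma lintegral_lintegral (hN : IsPoissonRandomMeasure P N ν) {φ : E → ℝ≥0∞}
    (hφ : Measurable φ) : ∫⁻ w, ∫⁻ z, φ z ∂(N w) ∂P = ∫⁻ z, φ z ∂ν := by
  rw [← hN.bind_eq, Measure.lintegral_bind hN.measurable.aemeasurable hφ.aemeasurable]

lemma ae_lintegral_lt_top (hN : IsPoissonRandomMeasure P N ν) {φ : E → ℝ≥0∞}
    (hφ : Measurable φ) (h : ∫⁻ z, φ z ∂ν ≠ ∞) : ∀ᵐ w ∂P, ∫⁻ z, φ z ∂(N w) < ∞ :=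
  ae_lt_top ((Measure.measurable_lintegral hφ).comp hN.measurable)
    (by rwa [← hN.lintegral_lintegral hφ] at h)

lemma measure_ne_zero_le (hN : IsPoissonRandomMeasure P N ν) {C : Set E} (hC : MeasurableSet C) :
    P {w | N w C ≠ 0} ≤ ν C := by
  have hm : Measurable fun w => N w C := (Measure.measurable_coe hC).comp hN.measurable
  have := Measure.map_apply (μ := P) hm (measurableSet_singleton (0 : ℝ≥0∞)).compl
  rw [hN.law C hC] at this
  exact this.symm.trans_le (extPoisson_ne_zero_le _)

lemma ae_sigmaFinite [SigmaFinite ν] (hN : IsPoissonRandomMeasure P N ν) :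
    ∀ᵐ w ∂P, SigmaFinite (N w) := by
  have : ∀ᵐ w ∂P, ∀ i, N w (spanningSets ν i) < ∞ := by
    refine ae_all_iff.2 fun i => ?_
    have hi := measurableSet_spanningSets ν i
    have := hN.ae_lintegral_lt_top (φ := (spanningSets ν i).indicator 1)
      (measurable_one.indicator hi)
      (by simpa [lintegral_indicator_one hi] using (measure_spanningSets_lt_top ν i).ne)
    simpa [lintegral_indicator_one hi] using this
  filter_upwards [this] with w hw
  exact ⟨⟨⟨spanningSets ν, fun _ => trivial, hw, iUnion_spanningSets ν⟩⟩⟩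

/-- Sets of vanishing intensity along a decreasing sequence are eventually avoided. -/
lemma ae_exists_measure_eq_zero (hN : IsPoissonRandomMeasure P N ν) {C : ℕ → Set E}
    (hC : ∀ n, MeasurableSet (C n)) (h : Filter.Tendsto (fun n => ν (C n)) .atTop (nhds 0)) :
    ∀ᵐ w ∂P, ∃ n, N w (C n) = 0 := by
  rw [ae_iff]
  refine le_antisymm (ge_of_tendsto' h fun n => ?_) zero_le
  refine (measure_mono fun w hw => ?_).trans (hN.measure_ne_zero_le (hC n))
  simp only [not_exists, mem_ofPred_eq] at hw ⊢
  exact hw n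

/-- If `φ` is `ν`-integrable off each of a sequence of sets of vanishing intensity, then `φ` is
almost surely `N`-integrable. -/
lemma ae_lintegral_lt_top_of_tendsto (hN : IsPoissonRandomMeasure P N ν) {C : ℕ → Set E}
    (hC : ∀ n, MeasurableSet (C n)) (h : Filter.Tendsto (fun n => ν (C n)) .atTop (nhds 0))
    {φ : E → ℝ≥0∞} (hφ : Measurable φ) (hfin : ∀ n, ∫⁻ z in (C n)ᶜ, φ z ∂ν ≠ ∞) :
    ∀ᵐ w ∂P, ∫⁻ z, φ z ∂(N w) < ∞ := by
  have h1 : ∀ᵐ w ∂P, ∀ n, ∫⁻ z, (C n)ᶜ.indicator φ z ∂(N w) < ∞ := ae_all_iff.2 fun n =>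
    hN.ae_lintegral_lt_top (hφ.indicator (hC n).compl)
      (by rw [lintegral_indicator (hC n).compl]; exact hfin n)
  filter_upwards [h1, hN.ae_exists_measure_eq_zero hC h] with w hw ⟨n, hn⟩
  refine lt_of_le_of_lt (lintegral_mono_ae ?_) (hw n)
  filter_upwards [measure_eq_zero_iff_ae_notMem.1 hn] with z hz
  rw [indicator_of_mem (by exact hz)]

end IsPoissonRandomMeasure

/-! ### Moments of the Gamma distribution. -/

lemma measurable_gammaPDF (a b : ℝ) : Measurable (gammaPDF a b) :=
  (measurable_gammaPDFReal a b).ennreal_ofReal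

lemma ae_gammaMeasure_pos (a b : ℝ) : ∀ᵐ l ∂(gammaMeasure a b), 0 < l := by
  rw [gammaMeasure, ae_withDensity_iff (measurable_gammaPDF a b)]
  filter_upwards [Measure.ae_ne volume (0 : ℝ)] with x hx h
  by_contra hn
  exact h (gammaPDF_of_neg (lt_of_le_of_ne (not_lt.1 hn) hx))

lemma gammaMeasure_Icc_one_two_ne_zero {a b : ℝ} (ha : 0 < a) (hb : 0 < b) :
    gammaMeasure a b (Icc 1 2) ≠ 0 := by
  rw [gammaMeasure, Ne, withDensity_apply_eq_zero (measurable_gammaPDF a b)]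
  have : {x | gammaPDF a b x ≠ 0} ∩ Icc 1 2 = Icc 1 2 := by
    refine inter_eq_right.2 fun x hx => ?_
    have := gammaPDFReal_pos ha hb (show 0 < x by linarith [hx.1])
    simpa [gammaPDF] using this
  rw [this]
  simp [Real.volume_Icc]

lemma lintegral_rpow_gammaMeasure_lt_top {a b t : ℝ} (hb : 0 < b) (hat : 0 < a + t) :
    ∫⁻ l, ENNReal.ofReal (l ^ t) ∂(gammaMeasure a b) < ∞ := by
  have hint : IntegrableOn (fun x : ℝ =>
      b ^ a / Real.Gamma a * (x ^ (a + t - 1) * Real.exp (-b * x))) (Ioi 0) := by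
    have := integrableOn_rpow_mul_exp_neg_mul_rpow (s := a + t - 1) (p := 1) (by linarith)
      one_pos hb
    simp only [Real.rpow_one] at this
    exact this.const_mul _
  rw [gammaMeasure, lintegral_withDensity_eq_lintegral_mul _ (measurable_gammaPDF a b)
    (by fun_prop)]
  refine lt_of_le_of_lt ?_ hint.lintegral_lt_top
  rw [← lintegral_indicator measurableSet_Ioi]
  refine lintegral_mono_ae ?_
  filter_upwards [Measure.ae_ne volume (0 : ℝ)] with x hx
  simp only [Pi.mul_apply]
  rcases lt_or_gt_of_ne hx with h | h
  · simp [gammaPDF_of_neg h]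
  · rw [indicator_of_mem (show x ∈ Ioi 0 from h), gammaPDF_of_nonneg h.le,
      ← ENNReal.ofReal_mul' (by positivity)]
    refine ENNReal.ofReal_le_ofReal (le_of_eq ?_)
    rw [show a + t - 1 = (a - 1) + t by ring, Real.rpow_add h, neg_mul]
    ring

/-! ### Integrability under the Lévy measure and summability of the jumps. -/

section Levy

variable {X : Set ℝ} {νβ : Measure ℝ} {a b : ℝ}

lemma ae_larkLevyMeasure_pos : ∀ᵐ z ∂(larkLevyMeasure νβ a b X), 0 < z.2.1 :=
  Measure.quasiMeasurePreserving_snd.ae (Measure.quasiMeasurePreserving_fst.ae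
    (ae_gammaMeasure_pos a b))

/-- Testing local integrability on `[1, 2] × X` suffices: the integral factors, and the Gamma mass
of `[1, 2]` is positive. -/
lemma volume_eq_zero_or_lintegral_lt_top (hX : IsCompact X) (ha : 0 < a) (hb : 0 < b)
    (hν : LocallyL1 (larkLevyMeasure νβ a b X) (Ioi 0 ×ˢ X)) :
    volume X = 0 ∨ ∫⁻ y, ENNReal.ofReal (min 1 |y|) ∂νβ < ∞ := by
  have := isProbabilityMeasure_gammaMeasure ha hb
  refine or_iff_not_imp_left.2 fun hX0 => ?_
  have h := hν (Icc 1 2 ×ˢ X) (isCompact_Icc.prod hX)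
    (prod_mono (fun x hx => lt_of_lt_of_le one_pos hx.1) subset_rfl)
  have hK : MeasurableSet (Icc (1 : ℝ) 2 ×ˢ X) := measurableSet_Icc.prod hX.measurableSet
  have hm : Measurable fun y : ℝ => ENNReal.ofReal (min 1 |y|) := by fun_prop
  rw [larkLevyMeasure, ← lintegral_indicator (MeasurableSet.univ.prod hK)] at h
  have e : ∀ z : ℝ × ℝ × ℝ, (univ ×ˢ (Icc (1 : ℝ) 2 ×ˢ X)).indicator
      (fun z : ℝ × ℝ × ℝ => ENNReal.ofReal (min 1 |z.1|)) z =
      ENNReal.ofReal (min 1 |z.1|) * (Icc (1 : ℝ) 2 ×ˢ X).indicator 1 z.2 := by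
    intro z
    by_cases hz : z.2 ∈ Icc (1 : ℝ) 2 ×ˢ X
    · rw [indicator_of_mem (show z ∈ univ ×ˢ _ from ⟨mem_univ _, hz⟩), indicator_of_mem hz]; simp
    · rw [indicator_of_notMem (fun h => hz h.2), indicator_of_notMem hz]; simp
  simp only [e] at h
  rw [lintegral_prod_mul hm.aemeasurable (measurable_one.indicator hK).aemeasurable,
    lintegral_indicator_one hK, Measure.prod_prod, Measure.restrict_apply_self] at h
  exact ENNReal.lt_top_of_mul_ne_top_left h.ne
    (mul_ne_zero (gammaMeasure_Icc_one_two_ne_zero ha hb) hX0)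

lemma lintegral_min_mul_larkLevyMeasure_lt_top (hX : IsCompact X) (ha : 0 < a) (hb : 0 < b)
    (hν : LocallyL1 (larkLevyMeasure νβ a b X) (Ioi 0 ×ˢ X)) {ψ : ℝ → ℝ≥0∞}
    (hψ : Measurable ψ) (hfin : ∫⁻ l, ψ l ∂(gammaMeasure a b) < ∞) :
    ∫⁻ z, ENNReal.ofReal (min 1 |z.1|) * ψ z.2.1 ∂(larkLevyMeasure νβ a b X) < ∞ := by
  have := isProbabilityMeasure_gammaMeasure ha hb
  have hm : Measurable fun y : ℝ => ENNReal.ofReal (min 1 |y|) := by fun_prop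
  rw [larkLevyMeasure, lintegral_prod_mul (g := fun y : ℝ × ℝ => ψ y.1) hm.aemeasurable
    (hψ.comp measurable_fst).aemeasurable]
  have e := lintegral_prod_mul (μ := gammaMeasure a b) (ν := volume.restrict X) (f := ψ)
    (g := fun _ => 1) hψ.aemeasurable aemeasurable_const
  simp only [mul_one, lintegral_one, Measure.restrict_apply_univ] at e
  rw [e]
  -- For null `X` the `νβ` factor may be infinite, but `∞ * 0 = 0`.
  rcases volume_eq_zero_or_lintegral_lt_top hX ha hb hν with h | h
  · simp [h]
  · exact ENNReal.mul_lt_top h (ENNReal.mul_lt_top hfin hX.measure_lt_top)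

lemma tendsto_larkLevyMeasure_large_jumps (hX : IsCompact X) (ha : 0 < a) (hb : 0 < b)
    (hν : LocallyL1 (larkLevyMeasure νβ a b X) (Ioi 0 ×ˢ X)) :
    Filter.Tendsto (fun n : ℕ => larkLevyMeasure νβ a b X {z | (n : ℝ) < |z.1|}) .atTop
      (nhds 0) := by
  have := isProbabilityMeasure_gammaMeasure ha hb
  have hms : ∀ n : ℕ, MeasurableSet {z : ℝ × ℝ × ℝ | (n : ℝ) < |z.1|} := fun n =>
    measurableSet_lt measurable_const (by fun_prop)
  have h1 := lintegral_min_mul_larkLevyMeasure_lt_top hX ha hb hν (ψ := fun _ => 1)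
    measurable_const (by simp)
  -- Continuity from above needs one set of finite measure; `n = 0` may fail, as there can be
  -- infinitely many small jumps.
  have hfin : larkLevyMeasure νβ a b X {z | ((1 : ℕ) : ℝ) < |z.1|} ≠ ∞ := by
    refine (lt_of_le_of_lt ?_ h1).ne
    rw [← lintegral_indicator_one (hms 1)]
    refine lintegral_mono fun z => ?_
    by_cases hz : ((1 : ℕ) : ℝ) < |z.1|
    · rw [indicator_of_mem (by exact hz), min_eq_left (by simpa using hz.le)]; simp
    · rw [indicator_of_notMem (by exact hz)]; exact zero_le
  have := tendsto_measure_iInter_atTop (μ := larkLevyMeasure νβ a b X)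
    (fun n => (hms n).nullMeasurableSet)
    (fun i j hij z (hz : (j : ℝ) < |z.1|) => lt_of_le_of_lt (Nat.cast_le.2 hij) hz) ⟨1, hfin⟩
  have he : ⋂ n : ℕ, {z : ℝ × ℝ × ℝ | (n : ℝ) < |z.1|} = ∅ := by
    refine eq_empty_of_forall_notMem fun z hz => ?_
    obtain ⟨n, hn⟩ := exists_nat_gt |z.1|
    exact lt_asymm hn (mem_iInter.1 hz n)
  rwa [he, measure_empty] at this

/-- Only finitely many jumps exceed `1`, so the jump sizes need no moment for the weighted sum of
the jumps of a Poisson random measure to converge. -/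
lemma ae_lintegral_jump_mul_lt_top {Ω' : Type*} [MeasurableSpace Ω'] {P : Measure Ω'}
    {N : Ω' → Measure (ℝ × ℝ × ℝ)} (hX : IsCompact X) (ha : 0 < a) (hb : 0 < b)
    (hν : LocallyL1 (larkLevyMeasure νβ a b X) (Ioi 0 ×ˢ X))
    (hN : IsPoissonRandomMeasure P N (larkLevyMeasure νβ a b X)) {ψ : ℝ → ℝ≥0∞}
    (hψ : Measurable ψ) (hfin : ∫⁻ l, ψ l ∂(gammaMeasure a b) < ∞) :
    ∀ᵐ w ∂P, ∫⁻ z, ‖z.1‖ₑ * ψ z.2.1 ∂(N w) < ∞ := by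
  have hms : ∀ n : ℕ, MeasurableSet {z : ℝ × ℝ × ℝ | (n : ℝ) < |z.1|} := fun n =>
    measurableSet_lt measurable_const (by fun_prop)
  refine hN.ae_lintegral_lt_top_of_tendsto hms
    (tendsto_larkLevyMeasure_large_jumps hX ha hb hν) (by fun_prop) fun n => ?_
  have h := lintegral_min_mul_larkLevyMeasure_lt_top hX ha hb hν hψ hfin
  -- If `|β| ≤ n`, then `|β| ≤ (n + 1) min 1 |β|`.
  refine (lt_of_le_of_lt ?_ (ENNReal.mul_lt_top (a := ENNReal.ofReal (n + 1))
    ENNReal.ofReal_lt_top h)).ne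
  rw [← lintegral_const_mul _ (by fun_prop), ← lintegral_indicator (hms n).compl]
  refine lintegral_mono fun z => ?_
  by_cases hz : (n : ℝ) < |z.1|
  · rw [indicator_of_notMem (by simpa using hz)]; exact zero_le
  · rw [indicator_of_mem (by exact hz), ← mul_assoc, ← ENNReal.ofReal_mul (by positivity)]
    gcongr
    rw [Real.enorm_eq_ofReal_abs]
    refine ENNReal.ofReal_le_ofReal ?_
    have h0 := abs_nonneg z.1
    have hn : (0 : ℝ) ≤ n := n.cast_nonneg
    rcases le_total 1 |z.1| with h1 | h1
    · rw [min_eq_left h1]; linarith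
    · rw [min_eq_right h1]; nlinarith

end Levy

/-! ### Minkowski's integral inequality. -/

/-- **Minkowski's integral inequality**. -/
lemma lintegral_rpow_lintegral_le {α β : Type*} [MeasurableSpace α] [MeasurableSpace β]
    (μ : Measure α) (ν : Measure β) [SFinite μ] [SFinite ν] {F : α → β → ℝ≥0∞}
    (hF : Measurable (Function.uncurry F)) {p : ℝ} (hp : 1 ≤ p) :
    (∫⁻ x, (∫⁻ z, F x z ∂ν) ^ p ∂μ) ^ (1 / p) ≤ ∫⁻ z, (∫⁻ x, F x z ^ p ∂μ) ^ (1 / p) ∂ν := by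
  have hp0 : 0 < p := by linarith
  rcases hp.eq_or_lt with rfl | hp1
  · simp only [ENNReal.rpow_one, div_one]
    exact (lintegral_lintegral_swap hF.aemeasurable).le
  set w : β → ℝ≥0∞ := fun z => (∫⁻ x, F x z ^ p ∂μ) ^ (1 / p) with hw
  have hFp : Measurable fun q : α × β => F q.1 q.2 ^ p := hF.pow_const p
  have hwm : Measurable w := (hFp.lintegral_prod_left').pow_const _
  set W := ∫⁻ z, w z ∂ν with hW
  by_cases hWt : W = ∞
  · rw [hWt]; exact le_top
  have hwt : ∀ᵐ z ∂ν, w z < ∞ := ae_lt_top hwm hWt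
  have hwp : ∀ z, w z ^ p = ∫⁻ x, F x z ^ p ∂μ := fun z => by
    rw [hw]; simp only; rw [← ENNReal.rpow_mul, one_div_mul_cancel hp0.ne', ENNReal.rpow_one]
  -- off a null set, `F x z` vanishes whenever `w z` does
  have hae : ∀ᵐ x ∂μ, ∀ᵐ z ∂ν, w z = 0 → F x z = 0 := by
    have hms : MeasurableSet {q : α × β | w q.2 = 0 → F q.1 q.2 = 0} := by
      have : {q : α × β | w q.2 = 0 → F q.1 q.2 = 0} =
          (w ∘ Prod.snd) ⁻¹' {0}ᶜ ∪ (Function.uncurry F) ⁻¹' {0} := by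
        ext q; simp [Function.uncurry, imp_iff_not_or]
      rw [this]
      exact ((hwm.comp measurable_snd) (measurableSet_singleton _).compl).union
        (hF (measurableSet_singleton _))
    refine (Measure.ae_ae_comm (μ := μ) (ν := ν) hms).2 (.of_forall fun z => ?_)
    by_cases hz : w z = 0
    · have h0 := hwp z
      rw [hz, ENNReal.zero_rpow_of_pos hp0] at h0
      have hm : Measurable fun x => F x z ^ p := hFp.comp measurable_prodMk_right
      filter_upwards [(lintegral_eq_zero_iff hm).1 h0.symm] with x hx _
      simpa [hp0, hp0.le.not_gt] using hx
    · exact .of_forall fun x h => absurd h hz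
  have hpq : p.HolderConjugate (p.conjExponent) := Real.HolderConjugate.conjExponent hp1
  set r := p.conjExponent with hr
  have hr0 : 0 < r := hpq.symm.pos
  have hr1 : 1 / r = 1 - 1 / p := by
    have := hpq.inv_add_inv_eq_one
    simp only [one_div]; linarith
  -- Hölder's inequality with weight `w`
  have hkey : ∀ᵐ x ∂μ, (∫⁻ z, F x z ∂ν) ^ p ≤
      (∫⁻ z, F x z ^ p * w z ^ (1 - p) ∂ν) * W ^ (p - 1) := by
    filter_upwards [hae] with x hx
    have hFx : Measurable (F x) := hF.comp measurable_prodMk_left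
    have h1 : ∫⁻ z, F x z ∂ν = ∫⁻ z, (F x z * w z ^ (-(1 / r))) * w z ^ (1 / r) ∂ν := by
      refine lintegral_congr_ae ?_
      filter_upwards [hx, hwt] with z hz hzt
      by_cases hz0 : w z = 0
      · simp [hz hz0]
      · rw [mul_assoc, ← ENNReal.rpow_add _ _ hz0 hzt.ne]; simp
    have h2 := ENNReal.lintegral_mul_le_Lp_mul_Lq ν hpq
      (hFx.mul (hwm.pow_const (-(1 / r)))).aemeasurable (hwm.pow_const (1 / r)).aemeasurable
    have h3 : ∀ z, (w z ^ (1 / r)) ^ r = w z := fun z => by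
      rw [← ENNReal.rpow_mul, one_div_mul_cancel hr0.ne', ENNReal.rpow_one]
    have h4 : ∀ z, (F x z * w z ^ (-(1 / r))) ^ p = F x z ^ p * w z ^ (1 - p) := fun z => by
      rw [ENNReal.mul_rpow_of_nonneg _ _ hp0.le, ← ENNReal.rpow_mul, hr1]
      congr 2; field_simp; ring
    simp only [Pi.mul_apply, h3, h4] at h2
    rw [← h1] at h2
    refine (ENNReal.rpow_le_rpow h2 hp0.le).trans_eq ?_
    rw [ENNReal.mul_rpow_of_nonneg _ _ hp0.le, ← ENNReal.rpow_mul, ← ENNReal.rpow_mul,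
      one_div_mul_cancel hp0.ne', ENNReal.rpow_one, hr1]
    congr 2; field_simp
  have hm2 : Measurable fun q : α × β => F q.1 q.2 ^ p * w q.2 ^ (1 - p) :=
    hFp.mul ((hwm.comp measurable_snd).pow_const _)
  -- After Tonelli, the inner integral over `x` is `w^p`, and `w^p * w^(1 - p)` collapses to `w`.
  have hmain : ∫⁻ x, (∫⁻ z, F x z ∂ν) ^ p ∂μ ≤ W ^ p := by
    calc ∫⁻ x, (∫⁻ z, F x z ∂ν) ^ p ∂μ
        ≤ ∫⁻ x, (∫⁻ z, F x z ^ p * w z ^ (1 - p) ∂ν) * W ^ (p - 1) ∂μ := lintegral_mono_ae hkey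
      _ = (∫⁻ z, ∫⁻ x, F x z ^ p * w z ^ (1 - p) ∂μ ∂ν) * W ^ (p - 1) := by
          rw [lintegral_mul_const _ hm2.lintegral_prod_right',
            lintegral_lintegral_swap hm2.aemeasurable]
      _ = (∫⁻ z, w z ^ p * w z ^ (1 - p) ∂ν) * W ^ (p - 1) := by
          congr 2; ext z
          have hm : Measurable fun x => F x z ^ p := hFp.comp measurable_prodMk_right
          rw [lintegral_mul_const _ hm, hwp]
      _ ≤ W * W ^ (p - 1) := by
          gcongr
          refine lintegral_mono_ae ?_
          filter_upwards [hwt] with z hz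
          by_cases hz0 : w z = 0
          · simp [hz0, hp0]
          · rw [← ENNReal.rpow_add _ _ hz0 hz.ne]; simp
      _ = W ^ p := by
          by_cases hW0 : W = 0
          · simp [hW0, hp0]
          · nth_rewrite 1 [← ENNReal.rpow_one W]
            rw [← ENNReal.rpow_add _ _ hW0 hWt]; simp
  calc _ ≤ (W ^ p) ^ (1 / p) := ENNReal.rpow_le_rpow hmain (by positivity)
    _ = W := by rw [← ENNReal.rpow_mul, mul_one_div_cancel hp0.ne', ENNReal.rpow_one]

lemma eLpNorm_ofReal_eq_lintegral {α : Type*} [MeasurableSpace α] {p : ℝ} (hp : 0 < p)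
    (u : α → ℝ) (μ : Measure α) :
    eLpNorm u (ENNReal.ofReal p) μ = (∫⁻ x, ‖u x‖ₑ ^ p ∂μ) ^ (1 / p) := by
  rw [eLpNorm_eq_lintegral_rpow_enorm_toReal (by simpa using hp) ENNReal.ofReal_ne_top,
    ENNReal.toReal_ofReal hp.le]

/-- Minkowski's integral inequality for `L_p` seminorms. -/
lemma eLpNorm_integral_le {α β : Type*} [MeasurableSpace α] [MeasurableSpace β]
    (μ : Measure α) (ν : Measure β) [SFinite μ] [SFinite ν] {F : α → β → ℝ}
    (hF : Measurable (Function.uncurry F)) {p : ℝ} (hp : 1 ≤ p) :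
    eLpNorm (fun x => ∫ z, F x z ∂ν) (ENNReal.ofReal p) μ ≤
      ∫⁻ z, eLpNorm (fun x => F x z) (ENNReal.ofReal p) μ ∂ν := by
  have hp0 : 0 < p := by linarith
  simp only [eLpNorm_ofReal_eq_lintegral hp0]
  refine le_trans ?_ (lintegral_rpow_lintegral_le μ ν (F := fun x z => ‖F x z‖ₑ) hF.enorm hp)
  gcongr
  exact enorm_integral_le_lintegral_enorm _

/-! ### Scaling, finite differences and the Besov modulus. -/

lemma lintegral_comp_mul_left {φ : ℝ → ℝ≥0∞} (hφ : Measurable φ) {l : ℝ} (hl : 0 < l) :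
    ∫⁻ x, φ (l * x) = ENNReal.ofReal l⁻¹ * ∫⁻ x, φ x := by
  rw [← lintegral_map hφ (measurable_const_mul l), Real.map_volume_mul_left hl.ne',
    lintegral_smul_measure, abs_of_pos (by positivity), smul_eq_mul]

lemma eLpNorm_comp_affine_mul {u : ℝ → ℝ} (hu : Measurable u) {p l : ℝ} (hp : 0 < p) (hl : 0 < l)
    (c y : ℝ) :
    eLpNorm (fun x => u (l * (x - c)) * y) (ENNReal.ofReal p) volume =
      ‖y‖ₑ * (ENNReal.ofReal (l ^ (-(1 / p))) * eLpNorm u (ENNReal.ofReal p) volume) := by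
  simp only [eLpNorm_ofReal_eq_lintegral hp, enorm_mul, ENNReal.mul_rpow_of_nonneg _ _ hp.le]
  have hm : Measurable fun x => ‖u x‖ₑ ^ p := by fun_prop
  have hm2 : Measurable fun x => ‖u (l * (x - c))‖ₑ ^ p := by fun_prop
  rw [lintegral_mul_const _ hm2, lintegral_sub_right_eq_self (fun x => ‖u (l * x)‖ₑ ^ p) c,
    lintegral_comp_mul_left hm hl, ENNReal.mul_rpow_of_nonneg _ _ (by positivity),
    ENNReal.mul_rpow_of_nonneg _ _ (by positivity), ← ENNReal.rpow_mul,
    mul_one_div_cancel hp.ne', ENNReal.rpow_one, ENNReal.ofReal_rpow_of_pos (by positivity),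
    Real.inv_rpow hl.le, ← Real.rpow_neg hl.le, mul_comm]

lemma fwdDiff_iter_eq_sum_mul (h : ℝ) (u : ℝ → ℝ) (m : ℕ) (x : ℝ) :
    (fwdDiff h)^[m] u x = ∑ k ∈ Finset.range (m + 1),
      ((-1 : ℝ) ^ (m - k) * m.choose k) * u (x + k * h) := by
  simp [fwdDiff_iter_eq_sum_shift]

lemma measurable_fwdDiff_iter {u : ℝ → ℝ} (hu : Measurable u) (m : ℕ) :
    Measurable fun q : ℝ × ℝ => (fwdDiff q.1)^[m] u q.2 := by
  simp only [fwdDiff_iter_eq_sum_mul]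
  fun_prop

lemma measurable_fwdDiff_iter_right {u : ℝ → ℝ} (hu : Measurable u) (m : ℕ) (h : ℝ) :
    Measurable ((fwdDiff h)^[m] u) :=
  (measurable_fwdDiff_iter hu m).comp measurable_prodMk_left

lemma eLpNorm_fwdDiff_iter_le {u : ℝ → ℝ} (hu : Measurable u) {p : ℝ≥0∞} (hp : 1 ≤ p) (h : ℝ)
    (m : ℕ) : eLpNorm ((fwdDiff h)^[m] u) p volume ≤ 2 ^ m * eLpNorm u p volume := by
  induction m with
  | zero => simp
  | succ m ih =>
    set v := (fwdDiff h)^[m] u with hv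
    have hvm : Measurable v := measurable_fwdDiff_iter_right hu m h
    have e : (fwdDiff h)^[m + 1] u = (fun x => v (x + h)) - v := by
      rw [Function.iterate_succ_apply']; rfl
    have hs : eLpNorm (fun x => v (x + h)) p volume = eLpNorm v p volume :=
      eLpNorm_comp_measurePreserving hvm.aestronglyMeasurable (measurePreserving_add_right _ h)
    rw [e]
    refine (eLpNorm_sub_le (hvm.comp (measurable_add_const h)).aestronglyMeasurable
      hvm.aestronglyMeasurable hp).trans ?_
    refine (congrArg (· + _) hs).trans_le ?_
    rw [← two_mul, pow_succ', mul_assoc]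
    gcongr

lemma stepDomain_univ (m : ℕ) (h : ℝ) : stepDomain univ m h = univ := by
  simp [stepDomain]

lemma besovSeminorm_lt_top_iff {D : Set ℝ} {p q s : ℝ} (hq : 0 < q) {u : ℝ → ℝ} :
    besovSeminorm D p q s u < ∞ ↔
      ∫⁻ h in Ioo (0 : ℝ) 1, ENNReal.ofReal (h ^ (-1 - s * q)) *
        eLpNorm ((fwdDiff h)^[⌊s⌋₊ + 1] u) (ENNReal.ofReal p)
          (volume.restrict (stepDomain D (⌊s⌋₊ + 1) h)) ^ q < ∞ := by
  rw [besovSeminorm, ENNReal.rpow_lt_top_iff_of_pos (by positivity), ENNReal.mul_lt_top_iff]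
  constructor
  · rintro (h | h | h)
    · exact h.2
    · simp at h
    · exact h ▸ ENNReal.zero_lt_top
  · exact fun h => Or.inl ⟨by simp, h⟩

lemma besovSeminorm_lt_top_of_univ {D : Set ℝ} {p q s : ℝ} (hq : 0 < q) {u : ℝ → ℝ}
    (h : besovSeminorm univ p q s u < ∞) : besovSeminorm D p q s u < ∞ := by
  rw [besovSeminorm_lt_top_iff hq] at h ⊢
  refine lt_of_le_of_lt (lintegral_mono fun t => ?_) h
  simp only [stepDomain_univ, Measure.restrict_univ]
  gcongr
  exact Measure.restrict_le_self

/-- The Besov modulus integral over all step sizes is finite. -/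
lemma lintegral_Ioi_modulus_lt_top {u : ℝ → ℝ} (hu : Measurable u) {p q s : ℝ} (hp : 1 ≤ p)
    (hq : 0 < q) (hs : 0 < s) (h : MemBesov univ p q s u) :
    ∫⁻ h in Ioi (0 : ℝ), ENNReal.ofReal (h ^ (-1 - s * q)) *
      eLpNorm ((fwdDiff h)^[⌊s⌋₊ + 1] u) (ENNReal.ofReal p) volume ^ q < ∞ := by
  have h1 := (besovSeminorm_lt_top_iff hq).1 h.2
  simp only [stepDomain_univ, Measure.restrict_univ] at h1
  have hsub : Ioi (0 : ℝ) ⊆ Ioo 0 1 ∪ Ioi (1 / 2) := fun x (hx : 0 < x) => by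
    rcases lt_or_ge x 1 with h | h
    · exact Or.inl ⟨hx, h⟩
    · exact Or.inr (show 1 / 2 < x by linarith)
  refine lt_of_le_of_lt (lintegral_mono_set hsub) (lt_of_le_of_lt (lintegral_union_le _ _ _) ?_)
  refine ENNReal.add_lt_top.2 ⟨h1, ?_⟩
  -- For large steps the modulus is at most `2^m ‖u‖_p`, and the weight is integrable at infinity.
  have hint := (integrableOn_Ioi_rpow_of_lt (a := -1 - s * q) (c := 1 / 2)
    (by nlinarith) (by norm_num)).lintegral_lt_top
  have hK : (2 ^ (⌊s⌋₊ + 1) * eLpNorm u (ENNReal.ofReal p) volume) ^ q < ∞ := by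
    have := h.1.2
    rw [Measure.restrict_univ] at this
    exact ENNReal.rpow_lt_top_of_nonneg hq.le
      (ENNReal.mul_lt_top (by simp) this).ne
  refine lt_of_le_of_lt ?_ (ENNReal.mul_lt_top hint hK)
  rw [← lintegral_mul_const _ (by fun_prop)]
  gcongr with t
  exact eLpNorm_fwdDiff_iter_le hu (by simpa using hp) _ _

/-- Substituting `l * h` carries `(0, 1)` to `(0, l)`; enlarging this to `(0, ∞)` makes the bound
uniform in `l` up to the factor `l^c`. -/
lemma lintegral_modulus_scale_le {G : ℝ → ℝ≥0∞} (hG : Measurable G) {c l : ℝ} (hl : 0 < l) :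
    ∫⁻ h in Ioo (0 : ℝ) 1, ENNReal.ofReal (h ^ (-1 - c)) * G (l * h) ≤
      ENNReal.ofReal (l ^ c) * ∫⁻ h in Ioi (0 : ℝ), ENNReal.ofReal (h ^ (-1 - c)) * G h := by
  set φ : ℝ → ℝ≥0∞ := (Ioi (0 : ℝ)).indicator fun h => ENNReal.ofReal (h ^ (-1 - c)) * G h with hφ
  have hφm : Measurable φ := Measurable.indicator (by fun_prop) measurableSet_Ioi
  have h1 := lintegral_comp_mul_left hφm hl
  have hle : ∫⁻ h in Ioo (0 : ℝ) 1, ENNReal.ofReal (h ^ (-1 - c)) * G (l * h) ≤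
      ∫⁻ h, ENNReal.ofReal (l ^ (1 + c)) * φ (l * h) := by
    rw [← lintegral_indicator measurableSet_Ioo]
    refine lintegral_mono fun h => ?_
    by_cases hh : h ∈ Ioo (0 : ℝ) 1
    · have hlh : 0 < l * h := mul_pos hl hh.1
      rw [indicator_of_mem hh, hφ, indicator_of_mem (show l * h ∈ Ioi 0 from hlh), ← mul_assoc,
        ← ENNReal.ofReal_mul (by positivity), Real.mul_rpow hl.le hh.1.le, ← mul_assoc,
        ← Real.rpow_add hl, show 1 + c + (-1 - c) = 0 by ring, Real.rpow_zero, one_mul]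
    · rw [indicator_of_notMem hh]; exact zero_le
  refine hle.trans_eq ?_
  have hm : Measurable fun h => φ (l * h) := hφm.comp (measurable_const_mul l)
  rw [lintegral_const_mul _ hm, h1, hφ, lintegral_indicator measurableSet_Ioi, ← mul_assoc,
    ← ENNReal.ofReal_mul (by positivity), Real.rpow_add hl, Real.rpow_one]
  congr 2
  field_simp

/-! ### Pathwise bounds for the LARK function. -/

section larkFun

variable {g : ℝ → ℝ} {M : Measure (ℝ × ℝ × ℝ)}

lemma measurable_larkTerm (hg : Measurable g) :
    Measurable fun q : ℝ × (ℝ × ℝ × ℝ) => larkTerm g q.1 q.2 := by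
  unfold larkTerm; fun_prop

lemma fwdDiff_iter_larkTerm (h : ℝ) (m : ℕ) (x : ℝ) (z : ℝ × ℝ × ℝ) :
    (fwdDiff h)^[m] (fun x => larkTerm g x z) x =
      (fwdDiff (z.2.1 * h))^[m] g (z.2.1 * (x - z.2.2)) * z.1 := by
  simp only [fwdDiff_iter_eq_sum_mul, larkTerm, Finset.sum_mul]
  refine Finset.sum_congr rfl fun k _ => ?_
  rw [show z.2.1 * (x + k * h - z.2.2) = z.2.1 * (x - z.2.2) + k * (z.2.1 * h) by ring]
  ring

lemma fwdDiff_iter_larkFun (hint : ∀ x, Integrable (larkTerm g x) M) (h : ℝ) (m : ℕ) (x : ℝ) :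
    (fwdDiff h)^[m] (larkFun g M) x =
      ∫ z, (fwdDiff h)^[m] (fun x => larkTerm g x z) x ∂M := by
  simp only [fwdDiff_iter_eq_sum_mul, larkFun]
  rw [integral_finsetSum _ fun k _ => (hint _).const_mul _]
  simp only [integral_const_mul]

lemma measurable_larkFun [SFinite M] (hg : Measurable g) : Measurable (larkFun g M) :=
  ((measurable_larkTerm hg).stronglyMeasurable.integral_prod_right).measurable

lemma integrable_larkTerm (hg : Measurable g) {C : ℝ} (hC : ∀ x, |g x| ≤ C)
    (h : ∫⁻ z, ‖z.1‖ₑ ∂M < ∞) (x : ℝ) : Integrable (larkTerm g x) M := by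
  have h1 : Integrable (fun z : ℝ × ℝ × ℝ => z.1) M :=
    ⟨measurable_fst.aestronglyMeasurable, h⟩
  exact h1.bdd_mul (c := C)
    (hg.comp (by fun_prop : Measurable fun z : ℝ × ℝ × ℝ => z.2.1 * (x - z.2.2))).aestronglyMeasurable
    (.of_forall fun z => hC _)

lemma abs_larkFun_le {C : ℝ} (hC : ∀ x, |g x| ≤ C)
    (h : ∫⁻ z, ‖z.1‖ₑ ∂M < ∞) (x : ℝ) : |larkFun g M x| ≤ C * ∫ z, |z.1| ∂M := by
  have h1 : Integrable (fun z : ℝ × ℝ × ℝ => z.1) M :=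
    ⟨measurable_fst.aestronglyMeasurable, h⟩
  rw [← integral_const_mul]
  refine norm_integral_le_of_norm_le (f := larkTerm g x) (h1.abs.const_mul C) (.of_forall fun z => ?_)
  rw [larkTerm, norm_mul]
  exact mul_le_mul_of_nonneg_right (hC _) (norm_nonneg _)

lemma memLp_larkFun_of_isCompact [SFinite M] (hg : Measurable g) {C : ℝ} (hC : ∀ x, |g x| ≤ C)
    (h : ∫⁻ z, ‖z.1‖ₑ ∂M < ∞) {X : Set ℝ} (hX : IsCompact X) (p : ℝ≥0∞) :
    MemLp (larkFun g M) p (volume.restrict X) := by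
  have : IsFiniteMeasure (volume.restrict X) := ⟨by simpa using hX.measure_lt_top⟩
  exact MemLp.of_bound (measurable_larkFun hg).aestronglyMeasurable _
    (.of_forall fun x => abs_larkFun_le hC h x)

lemma memLp_larkFun [SFinite M] (hg : Measurable g) {p : ℝ} (hp : 1 ≤ p)
    (hgp : MemLp g (ENNReal.ofReal p) volume) (hpos : ∀ᵐ z ∂M, 0 < z.2.1)
    (h : ∫⁻ z, ‖z.1‖ₑ * ENNReal.ofReal (z.2.1 ^ (-(1 / p))) ∂M < ∞) :
    MemLp (larkFun g M) (ENNReal.ofReal p) volume := by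
  refine ⟨(measurable_larkFun hg).aestronglyMeasurable, ?_⟩
  refine (eLpNorm_integral_le volume M (F := larkTerm g) (measurable_larkTerm hg) hp).trans_lt ?_
  refine lt_of_le_of_lt ?_ (ENNReal.mul_lt_top h hgp.2)
  rw [← lintegral_mul_const _ (by fun_prop)]
  refine lintegral_mono_ae ?_
  filter_upwards [hpos] with z hz
  rw [mul_assoc]
  exact (eLpNorm_comp_affine_mul hg (by linarith) hz _ _).le

/-- Minkowski is used twice, in `L_p` of the position and then in `L_q` of the step size. A step `h`
for `f` is a step `λ h` for `g`, so scaling contributes `λ^(-1/p)` and then `λ^s`. -/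
lemma besovSeminorm_larkFun_lt_top [SFinite M] (hg : Measurable g) {p q s : ℝ} (hp : 1 ≤ p)
    (hq : 1 ≤ q) (hs : 0 < s) (hgB : MemBesov univ p q s g)
    (hint : ∀ x, Integrable (larkTerm g x) M) (hpos : ∀ᵐ z ∂M, 0 < z.2.1)
    (h : ∫⁻ z, ‖z.1‖ₑ * ENNReal.ofReal (z.2.1 ^ (s - 1 / p)) ∂M < ∞) :
    besovSeminorm univ p q s (larkFun g M) < ∞ := by
  have hp0 : 0 < p := by linarith
  have hq0 : 0 < q := by linarith
  rw [besovSeminorm_lt_top_iff hq0]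
  simp only [stepDomain_univ, Measure.restrict_univ]
  set m := ⌊s⌋₊ + 1
  set G : ℝ → ℝ≥0∞ := fun h => eLpNorm ((fwdDiff h)^[m] g) (ENNReal.ofReal p) volume with hGdef
  have hG : Measurable G := by
    simp only [hGdef, eLpNorm_ofReal_eq_lintegral hp0]
    exact ((measurable_fwdDiff_iter hg m).enorm.pow_const p).lintegral_prod_right'.pow_const _
  set T : ℝ → ℝ × ℝ × ℝ → ℝ → ℝ := fun h z => (fwdDiff h)^[m] (fun x => larkTerm g x z) with hT
  have hTm : Measurable fun r : (ℝ × (ℝ × ℝ × ℝ)) × ℝ => T r.1.1 r.1.2 r.2 := by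
    simp only [hT, fwdDiff_iter_larkTerm]
    exact ((measurable_fwdDiff_iter hg m).comp
      (f := fun r : (ℝ × (ℝ × ℝ × ℝ)) × ℝ =>
        (r.1.2.2.1 * r.1.1, r.1.2.2.1 * (r.2 - r.1.2.2.2))) (by fun_prop)).mul (by fun_prop)
  set e : ℝ → ℝ × ℝ × ℝ → ℝ≥0∞ := fun h z => eLpNorm (T h z) (ENNReal.ofReal p) volume with he
  have hem : Measurable (Function.uncurry e) := by
    simp only [Function.uncurry_def, he, eLpNorm_ofReal_eq_lintegral hp0]
    exact (hTm.enorm.pow_const p).lintegral_prod_right'.pow_const _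
  have hstep : ∀ t, eLpNorm ((fwdDiff t)^[m] (larkFun g M)) (ENNReal.ofReal p) volume ≤
      ∫⁻ z, e t z ∂M := fun t => by
    rw [funext (fwdDiff_iter_larkFun hint t m)]
    refine eLpNorm_integral_le volume M (F := fun x z => T t z x) ?_ hp
    exact hTm.comp (f := fun r : ℝ × (ℝ × ℝ × ℝ) => ((t, r.2), r.1)) (by fun_prop)
  -- Absorbing the Besov weight into `κ` makes the seminorm, up to a constant, an `L_q(κ)` norm.
  set κ : Measure ℝ := (volume.restrict (Ioo (0 : ℝ) 1)).withDensity
    fun t => ENNReal.ofReal (t ^ (-1 - s * q)) with hκ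
  have hκi : ∀ {φ : ℝ → ℝ≥0∞}, Measurable φ → ∫⁻ t, φ t ∂κ =
      ∫⁻ t in Ioo (0 : ℝ) 1, ENNReal.ofReal (t ^ (-1 - s * q)) * φ t := fun hφ => by
    rw [hκ, lintegral_withDensity_eq_lintegral_mul _ (by fun_prop) hφ]; rfl
  set J := ∫⁻ t in Ioi (0 : ℝ), ENNReal.ofReal (t ^ (-1 - s * q)) * G t ^ q with hJ
  have hJt : J < ∞ := lintegral_Ioi_modulus_lt_top hg hp hq0 hs hgB
  have hterm : ∀ᵐ z ∂M, (∫⁻ t, e t z ^ q ∂κ) ^ (1 / q) ≤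
      ‖z.1‖ₑ * ENNReal.ofReal (z.2.1 ^ (s - 1 / p)) * J ^ (1 / q) := by
    filter_upwards [hpos] with z hz
    have he' : ∀ t, e t z = ‖z.1‖ₑ * ENNReal.ofReal (z.2.1 ^ (-(1 / p))) * G (z.2.1 * t) := by
      intro t
      rw [mul_assoc, ← eLpNorm_comp_affine_mul (measurable_fwdDiff_iter_right hg m (z.2.1 * t))
        hp0 hz z.2.2 z.1]
      simp only [he, hT]
      congr 1
      ext x
      exact fwdDiff_iter_larkTerm t m x z
    have hGz : Measurable fun t => G (z.2.1 * t) ^ q := by fun_prop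
    simp only [he', ENNReal.mul_rpow_of_nonneg _ (G _) hq0.le]
    rw [lintegral_const_mul _ hGz, hκi hGz]
    calc _ ≤ ((‖z.1‖ₑ * ENNReal.ofReal (z.2.1 ^ (-(1 / p)))) ^ q *
          (ENNReal.ofReal (z.2.1 ^ (s * q)) * J)) ^ (1 / q) := by
          gcongr
          exact lintegral_modulus_scale_le (hG.pow_const q) hz
      _ = _ := by
          rw [ENNReal.mul_rpow_of_nonneg _ _ (by positivity),
            ENNReal.mul_rpow_of_nonneg _ J (by positivity), ← ENNReal.rpow_mul,
            mul_one_div_cancel hq0.ne', ENNReal.rpow_one,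
            ENNReal.ofReal_rpow_of_pos (by positivity), ← Real.rpow_mul hz.le,
            mul_assoc s, mul_one_div_cancel hq0.ne', mul_one, ← mul_assoc, mul_assoc ‖z.1‖ₑ,
            ← ENNReal.ofReal_mul (by positivity), ← Real.rpow_add hz,
            show -(1 / p) + s = s - 1 / p by ring]
  have hfin : (∫⁻ t, (∫⁻ z, e t z ∂M) ^ q ∂κ) ^ (1 / q) < ∞ := by
    refine (lintegral_rpow_lintegral_le κ M hem hq).trans_lt ?_
    refine (lintegral_mono_ae hterm).trans_lt ?_
    rw [lintegral_mul_const _ (by fun_prop)]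
    exact ENNReal.mul_lt_top h (ENNReal.rpow_lt_top_of_nonneg (by positivity) hJt.ne)
  have hem' : Measurable fun t => (∫⁻ z, e t z ∂M) ^ q := hem.lintegral_prod_right'.pow_const q
  rw [ENNReal.rpow_lt_top_iff_of_pos (by positivity), hκi hem'] at hfin
  refine lt_of_le_of_lt ?_ hfin
  gcongr with t
  exact hstep t

end larkFun

/-! ### Almost sure Besov regularity. -/

theorem corollary3 {Ω' : Type*} [MeasurableSpace Ω'] (P : Measure Ω') [IsProbabilityMeasure P]
    (X : Set ℝ) (hX : IsCompact X)
    (νβ : Measure ℝ) [SigmaFinite νβ] (a b : ℝ) (ha : 0 < a) (hb : 0 < b)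
    (hν : LocallyL1 (larkLevyMeasure νβ a b X) (Ioi 0 ×ˢ X))
    (N : Ω' → Measure (ℝ × ℝ × ℝ))
    (hN : IsPoissonRandomMeasure P N (larkLevyMeasure νβ a b X))
    (g : ℝ → ℝ) (hg : Measurable g) (hgb : ∃ C : ℝ, ∀ x, |g x| ≤ C) :
    (∀ᵐ w ∂P, ∀ x : ℝ, Integrable (larkTerm g x) (N w)) ∧
    (∀ p q s : ℝ, 1 ≤ p → 1 ≤ q → 0 < s → MemBesov univ p q s g → 1 / p < a →
      ∀ᵐ w ∂P, MemBesov univ p q s (larkFun g (N w)) ∧ MemBesov X p q s (larkFun g (N w))) ∧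
    (1 ≤ a → ∀ p q s : ℝ, 1 ≤ p → 1 ≤ q → 0 < s → MemBesov univ p q s g →
      ∀ᵐ w ∂P, MemBesov X p q s (larkFun g (N w)) ∧
        (1 < a ∨ 1 < p → MemBesov univ p q s (larkFun g (N w)))) := by
  obtain ⟨C, hC⟩ := hgb
  have := isProbabilityMeasure_gammaMeasure ha hb
  have hσ : SigmaFinite (larkLevyMeasure νβ a b X) := by
    unfold larkLevyMeasure
    have : IsFiniteMeasure (volume.restrict X) := ⟨by simpa using hX.measure_lt_top⟩
    infer_instance
  have hjump : ∀ᵐ w ∂P, ∫⁻ z, ‖z.1‖ₑ ∂(N w) < ∞ := by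
    simpa using ae_lintegral_jump_mul_lt_top hX ha hb hν hN (ψ := fun _ => 1)
      measurable_const (by simp)
  have hmoment : ∀ t : ℝ, 0 < a + t →
      ∀ᵐ w ∂P, ∫⁻ z, ‖z.1‖ₑ * ENNReal.ofReal (z.2.1 ^ t) ∂(N w) < ∞ := fun t ht =>
    ae_lintegral_jump_mul_lt_top hX ha hb hν hN (ψ := fun l => ENNReal.ofReal (l ^ t))
      (by fun_prop) (lintegral_rpow_gammaMeasure_lt_top hb ht)
  have hint : ∀ᵐ w ∂P, ∀ x : ℝ, Integrable (larkTerm g x) (N w) :=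
    hjump.mono fun w hw => integrable_larkTerm hg hC hw
  have hpos : ∀ᵐ w ∂P, ∀ᵐ z ∂(N w), 0 < z.2.1 := hN.ae_ae ae_larkLevyMeasure_pos
  -- Equality `1 / p = a` is admissible here, since `a + (s - 1 / p) > 0` still holds.
  have hsemi : ∀ p q s : ℝ, 1 ≤ p → 1 ≤ q → 0 < s → MemBesov univ p q s g → 1 / p ≤ a →
      ∀ᵐ w ∂P, besovSeminorm univ p q s (larkFun g (N w)) < ∞ ∧
        MemBesov X p q s (larkFun g (N w)) := by
    intro p q s hp hq hs hgB hpa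
    filter_upwards [hint, hpos, hN.ae_sigmaFinite, hjump, hmoment (s - 1 / p) (by linarith)]
      with w h1 h2 h3 h4 h5
    have := besovSeminorm_larkFun_lt_top hg hp hq hs hgB h1 h2 h5
    exact ⟨this, memLp_larkFun_of_isCompact hg hC h4 hX _,
      besovSeminorm_lt_top_of_univ (by linarith) this⟩
  have hfull : ∀ p q s : ℝ, 1 ≤ p → 1 ≤ q → 0 < s → MemBesov univ p q s g → 1 / p < a →
      ∀ᵐ w ∂P, MemBesov univ p q s (larkFun g (N w)) ∧ MemBesov X p q s (larkFun g (N w)) := by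
    intro p q s hp hq hs hgB hpa
    filter_upwards [hsemi p q s hp hq hs hgB hpa.le, hpos, hN.ae_sigmaFinite,
      hmoment (-(1 / p)) (by linarith)] with w h1 h2 h3 h4
    refine ⟨⟨?_, h1.1⟩, h1.2⟩
    rw [Measure.restrict_univ]
    exact memLp_larkFun hg hp (by simpa using hgB.1) h2 h4
  refine ⟨hint, hfull, fun ha1 p q s hp hq hs hgB => ?_⟩
  have hp1 : 1 / p ≤ 1 := by rw [div_le_one (by linarith)]; exact hp
  by_cases hap : 1 / p < a
  · exact (hfull p q s hp hq hs hgB hap).mono fun w hw => ⟨hw.2, fun _ => hw.1⟩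
  -- Here `a ≤ 1 / p ≤ 1 ≤ a`, which forces `a = p = 1`.
  · refine (hsemi p q s hp hq hs hgB (hp1.trans ha1)).mono fun w hw => ⟨hw.2, fun h => ?_⟩
    refine absurd ?_ hap
    rcases h with h | h
    · linarith
    · exact ((div_lt_one (by linarith)).2 h).trans_le ha1
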